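/- Let $l,m\in\mathbb N$, $q\in(1,\infty)$, and let $\Omega\subset\mathbb R^l$ be open and bounded with $|\partial\Omega|=0$. Let $C\subset\mathbb R^m$ be open and convex with $0\in C$, and let $f:\overline C\to[0,\infty]$ be convex and lower semicontinuous. Let $f_k:\mathbb R^m\to[0,\infty)$, $k\in\mathbb N$, be convex functions with $f_k(0)=0$ and $f_k(p)\ge c|p|^q-d$ for all $p\in\mathbb R^m$, where $c,d>0$ do not depend on $k$. Suppose that $f_k\to f$ uniformly on every compact subset of $C$ (in particular $f$ is finite on $C$) and that $f_k\to+\infty$ uniformly on every set that has positive distance to $\overline C$. Put $\mathcal F_k(U)=\int_\Omega f_k(U(x))\,dx$ and $\mathcal F(U)=\int_\Omega f(U(x))\,dx$, with values in $[0,\infty]$. A continuous function $\Phi:\overline\Omega\times\mathbb R^m\to\mathbb R$ is called $q$-admissible if the limit $\Phi^{q,\infty}(x,v)=\lim_{t\to\infty}t^{-q}\Phi(x,tv)$ exists, is finite, and is locally uniform in $(x,v)\in\overline\Omega\times(\mathbb R^m\setminus\{0\})$. Let $S$ be the unit sphere of $\mathbb R^m$. The $q$-Young measure of a sequence $(U_k)$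 is a triple $\boldsymbol\nu=((\nu_x)_{x\in\Omega},\lambda,(\nu_x^\infty)_{x\in\overline\Omega})$, where $(\nu_x)$ is a Lebesgue measurable family of probability measures on $\mathbb R^m$ with $\int_\Omega\int|v|^q\,d\nu_x(v)\,dx<\infty$, $\lambda$ is a finite positive Borel measure on $\overline\Omega$, and $(\nu^\infty_x)$ is a $\lambda$-measurable family of probability measures on $S$, such that for every $q$-admissible $\Phi$ $$\int_\Omega\Phi(x,U_k(x))\,dx\to\int_\Omega\int_{\mathbb R^m}\Phi(x,v)\,d\nu_x(v)\,dx+\int_{\overline\Omega}\int_S\Phi^{q,\infty}(x,v)\,d\nu^\infty_x(v)\,d\lambda(x).$$ Suppose that $U_k\rightharpoonup U$ weakly in $L^q(\Omega;\mathbb R^m)$, that $\boldsymbol\nu$ is the $q$-Young measure of $(U_k)$, and that $\sup_k\mathcal F_k(U_k)<\infty$. Then: (i) $\operatorname{supp}\nu_x\subset\overline C$ for a.e. $x\in\Omega$. (ii) $U(x)\in\overline C$ for a.e. $x\in\Omega$, and $\mathcal F(U)\le\liminf_{k\to\infty}\mathcal F_k(U_k)$. (iii) If equality holds in (ii), then $\lambda=0$,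 and for a.e. $x\in\Omega$ the following holds for every $w\in\mathbb R^m$: if there is a subgradient $z_0\in\mathbb R^m$ of $f$ at $U(x)$, i.e. $f(v)\ge f(U(x))+z_0\cdot(v-U(x))$ for all $v\in\overline C$, such that $$f(U(x)+sw)-f(U(x))>s\,z_0\cdot w\quad\text{for all }s\ne0\text{ with }U(x)+sw\in\overline C,$$ then $$\operatorname{supp}\nu_x\cap\{U(x)+\mathbb R w\}\subset\{U(x)\}.$$ -/

import Mathlib

open MeasureTheory Filter Topology
open scoped ENNReal NNReal

/-- `Ψ` is the `q`-recession function of `Φ`, and `Φ` is a `q`-admissible integrand on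
`closure Ω × ℝᵐ`: it is continuous there and `Φ (x, t v) / t ^ q → Ψ (x, v)` as `t → ∞`,
locally uniformly for `(x, v) ∈ closure Ω × (ℝᵐ \ {0})`. Only the values of `Φ` on
`closure Ω × ℝᵐ` and of `Ψ` on `closure Ω × (ℝᵐ \ {0})` matter. -/
def IsAdmissibleIntegrand {l m : ℕ} (Ω : Set (EuclideanSpace ℝ (Fin l))) (q : ℝ)
    (Φ Ψ : EuclideanSpace ℝ (Fin l) → EuclideanSpace ℝ (Fin m) → ℝ) : Prop :=
  ContinuousOn (fun z : EuclideanSpace ℝ (Fin l) × EuclideanSpace ℝ (Fin m) => Φ z.1 z.2)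
      (closure Ω ×ˢ Set.univ) ∧
    TendstoLocallyUniformlyOn
      (fun (t : ℝ) (z : EuclideanSpace ℝ (Fin l) × EuclideanSpace ℝ (Fin m)) =>
        Φ z.1 (t • z.2) / t ^ q)
      (fun z => Ψ z.1 z.2) atTop (closure Ω ×ˢ {0}ᶜ)

/-- `(ν, lam, νinf)` is the (generalized) `q`-Young measure generated by the sequence `U k`:
* `ν` is a Lebesgue measurable family of probability measures on `ℝᵐ` indexed by `Ω`
  (oscillation), with finite total `q`-th moment;
* `lam` is a finite Borel measure carried by `closure Ω` (concentration);
* `νinf` is a `lam`-measurable family of probability measures on the unit sphere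
  (concentration angle);
* for every `q`-admissible integrand, `∫_Ω Φ(x, U k x) dx` converges to the integral of `Φ`
  against `ν` plus the integral of its recession function against `νinf` and `lam`. -/
structure IsYoungMeasureOf {l m : ℕ} (Ω : Set (EuclideanSpace ℝ (Fin l))) (q : ℝ)
    (U : ℕ → EuclideanSpace ℝ (Fin l) → EuclideanSpace ℝ (Fin m))
    (ν : EuclideanSpace ℝ (Fin l) → Measure (EuclideanSpace ℝ (Fin m)))
    (lam : Measure (EuclideanSpace ℝ (Fin l)))
    (νinf : EuclideanSpace ℝ (Fin l) →
      Measure (Metric.sphere (0 : EuclideanSpace ℝ (Fin m)) 1)) : Prop where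
  aemeasurable_osc : AEMeasurable ν (volume.restrict Ω)
  isProbabilityMeasure_osc : ∀ᵐ x ∂(volume.restrict Ω), IsProbabilityMeasure (ν x)
  moment_lt_top : ∫⁻ x in Ω, ∫⁻ v, ‖v‖ₑ ^ q ∂(ν x) < ∞
  isFiniteMeasure_conc : IsFiniteMeasure lam
  conc_compl : lam (closure Ω)ᶜ = 0
  aemeasurable_angle : AEMeasurable νinf lam
  isProbabilityMeasure_angle : ∀ᵐ x ∂lam, IsProbabilityMeasure (νinf x)
  tendsto_integral : ∀ Φ Ψ : EuclideanSpace ℝ (Fin l) → EuclideanSpace ℝ (Fin m) → ℝ,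
    IsAdmissibleIntegrand Ω q Φ Ψ →
      Tendsto (fun k => ∫ x in Ω, Φ x (U k x)) atTop
        (𝓝 ((∫ x in Ω, ∫ v, Φ x v ∂(ν x)) + ∫ x, ∫ v, Ψ x v ∂(νinf x) ∂lam))

/-- Weak convergence `U k ⇀ V` in `L^q(Ω; ℝᵐ)`, `1 < q < ∞`: all functions are in `L^q`, and the
sequence converges when paired with any element of the dual space `L^{q'}`,
`q' = q / (q - 1)`. -/
def WeaklyConvergesLq {l m : ℕ} (Ω : Set (EuclideanSpace ℝ (Fin l))) (q : ℝ)
    (U : ℕ → EuclideanSpace ℝ (Fin l) → EuclideanSpace ℝ (Fin m))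
    (V : EuclideanSpace ℝ (Fin l) → EuclideanSpace ℝ (Fin m)) : Prop :=
  (∀ k, MemLp (U k) (ENNReal.ofReal q) (volume.restrict Ω)) ∧
    MemLp V (ENNReal.ofReal q) (volume.restrict Ω) ∧
    ∀ g : EuclideanSpace ℝ (Fin l) → EuclideanSpace ℝ (Fin m),
      MemLp g (ENNReal.ofReal (q / (q - 1))) (volume.restrict Ω) →
        Tendsto (fun k => ∫ x in Ω, inner ℝ (U k x) (g x)) atTop
          (𝓝 (∫ x in Ω, inner ℝ (V x) (g x)))

/-- `z` is a subgradient at `p` of the extended-valued function `f` with domain `D`. -/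
def IsSubgradientOn {m : ℕ} (D : Set (EuclideanSpace ℝ (Fin m)))
    (f : EuclideanSpace ℝ (Fin m) → ℝ≥0∞) (p z : EuclideanSpace ℝ (Fin m)) : Prop :=
  ∀ v ∈ D, (f p : EReal) + ((inner ℝ z (v - p) : ℝ) : EReal) ≤ (f v : EReal)

/-- The function `f` on `D` grows strictly faster along the line `p + ℝ w` than the affine function
with slope `z` that agrees with it at `p`. -/
def IsStrictAlong {m : ℕ} (D : Set (EuclideanSpace ℝ (Fin m)))
    (f : EuclideanSpace ℝ (Fin m) → ℝ≥0∞) (p z w : EuclideanSpace ℝ (Fin m)) : Prop :=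
  ∀ s : ℝ, s ≠ 0 → p + s • w ∈ D →
    (f p : EReal) + ((s * inner ℝ z w : ℝ) : EReal) < (f (p + s • w) : EReal)

/-! Let `F` be `f` extended by `∞` off `closure C`; it is lower semicontinuous, and its Lipschitz
envelopes `ψ n` are continuous, at most `n`, and recover `F` as `n → ∞`. The crux is
`eventually_lipEnvelope_le`: `ψ n ≤ fk k + ε` on all of `ℝᵐ` for large `k`. With coercivity, `max (ψ
n) (c|v|^q - d)` is then, up to `ε`, an admissible lower bound for `fk k` with recession function
`c|v|^q`. Passing to the Young measure limit and then applying Fatou in `n` gives `∫_Ω ∫ F dν_x dx +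
c · λ(closure Ω) ≤ liminf ∫_Ω fk k (Uk k)`.

Finiteness of the right side puts `ν_x` on `closure C`. Since `U x` is the barycenter of `ν_x`,
Jensen's inequality gives (ii). Equality in (ii) leaves no slack: `c λ = 0`, and Jensen is an
equality for a.e. `x`. Then `f` agrees on the support of `ν_x` with any affine minorant touching it
at `U x`, and strictness along `w` excludes every other point of that line. -/

/-- The extension of `f : D → [0, ∞]` by `∞` outside of `D`. -/
noncomputable def extendTop {E : Type*} (D : Set E) (f : E → ℝ≥0∞) (p : E) : ℝ≥0∞ :=
  open Classical in if p ∈ D then f p else ∞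

theorem extendTop_of_mem {E : Type*} {D : Set E} (f : E → ℝ≥0∞) {p : E} (hp : p ∈ D) :
    extendTop D f p = f p := if_pos hp

theorem extendTop_of_notMem {E : Type*} {D : Set E} (f : E → ℝ≥0∞) {p : E} (hp : p ∉ D) :
    extendTop D f p = ∞ := if_neg hp

theorem lowerSemicontinuous_extendTop {E : Type*} [TopologicalSpace E] {D : Set E}
    (hD : IsClosed D) {f : E → ℝ≥0∞} (hf : LowerSemicontinuousOn f D) :
    LowerSemicontinuous (extendTop D f) := by
  intro p a ha
  by_cases hp : p ∈ D
  · rw [extendTop_of_mem f hp] at ha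
    have := hf p hp a ha
    rw [eventually_nhdsWithin_iff] at this
    filter_upwards [this] with y hy
    by_cases hyD : y ∈ D
    · rw [extendTop_of_mem f hyD]; exact hy hyD
    · rw [extendTop_of_notMem f hyD]
      exact ha.trans_le le_top
  · rw [extendTop_of_notMem f hp] at ha
    filter_upwards [hD.isOpen_compl.mem_nhds hp] with y hy
    rwa [extendTop_of_notMem f hy]

/-! ### Lipschitz approximation from below -/

/-- The `n`-Lipschitz lower envelope of `min F n`. -/
noncomputable def lipEnvelope {E : Type*} [PseudoMetricSpace E] (F : E → ℝ≥0∞) (n : ℕ) (p : E) :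
    ℝ :=
  ⨅ y, ((min (F y) n).toReal + n * dist p y)

section LipEnvelope

variable {E : Type*} [PseudoMetricSpace E] (F : E → ℝ≥0∞) (n : ℕ)

theorem bddBelow_lipEnvelope (p : E) :
    BddBelow (Set.range fun y => (min (F y) n).toReal + n * dist p y) :=
  ⟨0, by rintro _ ⟨y, rfl⟩; dsimp only; positivity⟩

theorem lipEnvelope_nonneg (p : E) : 0 ≤ lipEnvelope F n p :=
  Real.iInf_nonneg fun y => by positivity

theorem lipEnvelope_le (p : E) : lipEnvelope F n p ≤ (min (F p) n).toReal := by
  refine (ciInf_le (bddBelow_lipEnvelope F n p) p).trans ?_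
  simp

theorem lipEnvelope_le_natCast (p : E) : lipEnvelope F n p ≤ n := by
  refine (lipEnvelope_le F n p).trans ?_
  refine (ENNReal.toReal_mono (by simp) (min_le_right _ _)).trans ?_
  simp

theorem ofReal_lipEnvelope_le (p : E) : ENNReal.ofReal (lipEnvelope F n p) ≤ F p := by
  refine (ENNReal.ofReal_le_ofReal (lipEnvelope_le F n p)).trans ?_
  exact ENNReal.ofReal_toReal_le.trans (min_le_left _ _)

theorem continuous_lipEnvelope : Continuous (lipEnvelope F n) := by
  refine LipschitzWith.continuous (K := n) (LipschitzWith.of_le_add_mul n fun p p' => ?_)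
  have : Nonempty E := ⟨p⟩
  rw [← sub_le_iff_le_add]
  refine le_ciInf fun y => ?_
  rw [sub_le_iff_le_add]
  refine (ciInf_le (bddBelow_lipEnvelope F n p) y).trans ?_
  have := mul_le_mul_of_nonneg_left (dist_triangle p p' y) (Nat.cast_nonneg (α := ℝ) n)
  simp only [NNReal.coe_natCast]
  linarith

variable {F}

/-- For `b < F p`, every competitor `y` in the infimum costs at least `b` once `n` is large: close
to `p` because `F y > b` by lower semicontinuity, and at distance at least `ρ` because of the
penalty `n * ρ`. -/
theorem le_liminf_lipEnvelope (hF : LowerSemicontinuous F) (p : E) :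
    F p ≤ liminf (fun n => ENNReal.ofReal (lipEnvelope F n p)) atTop := by
  refine le_of_forall_lt fun a ha => ?_
  obtain ⟨b, hab, hb⟩ := exists_between ha
  refine hab.trans_le ?_
  have hbt : b ≠ ∞ := hb.ne_top
  obtain ⟨ρ, hρ, hball⟩ := Metric.eventually_nhds_iff.1 (hF p b hb)
  obtain ⟨N, hN⟩ := exists_nat_ge (b.toReal / ρ)
  obtain ⟨N', hN'⟩ := exists_nat_ge b.toReal
  refine le_liminf_of_le (by isBoundedDefault) ?_
  filter_upwards [eventually_ge_atTop N, eventually_ge_atTop N'] with n hn hn'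
  rw [← ENNReal.ofReal_toReal hbt]
  refine ENNReal.ofReal_le_ofReal ?_
  have : Nonempty E := ⟨p⟩
  refine le_ciInf fun y => ?_
  by_cases hy : dist y p < ρ
  · have h1 : b ≤ min (F y) n := by
      refine le_min (hball hy).le ?_
      rw [← ENNReal.ofReal_toReal hbt, ← ENNReal.ofReal_natCast n]
      refine ENNReal.ofReal_le_ofReal (hN'.trans ?_)
      exact_mod_cast hn'
    have h2 := ENNReal.toReal_mono (by simp) h1
    have : 0 ≤ (n : ℝ) * dist p y := by positivity
    linarith
  · rw [not_lt, dist_comm] at hy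
    rw [div_le_iff₀ hρ] at hN
    have h3 : (N : ℝ) ≤ n := by exact_mod_cast hn
    have h4 : (N : ℝ) * ρ ≤ n * dist p y := by gcongr
    have : 0 ≤ (min (F y) (n : ℝ≥0∞)).toReal := by positivity
    linarith

end LipEnvelope

/-! ### Convexity along rays and the uniform lower bound for `fk` -/

section Convex

variable {E : Type*} [NormedAddCommGroup E] [NormedSpace ℝ E]

theorem smul_mem_of_mem_closure {C : Set E} (hC_open : IsOpen C) (hC_conv : Convex ℝ C)
    (hC_zero : (0 : E) ∈ C) {p : E} (hp : p ∈ closure C) {s : ℝ} (h0 : 0 ≤ s) (h1 : s < 1) :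
    s • p ∈ C := by
  have := hC_conv.combo_interior_closure_mem_interior (x := 0) (y := p) (a := 1 - s) (b := s)
    (by rwa [hC_open.interior_eq]) hp (by linarith) h0 (by ring)
  simpa [hC_open.interior_eq] using this

theorem ConvexOn.apply_smul_le_of_zero {g : E → ℝ} (hg : ConvexOn ℝ Set.univ g) (h0 : g 0 = 0)
    (hg0 : ∀ p, 0 ≤ g p) {s : ℝ} (hs0 : 0 ≤ s) (hs1 : s ≤ 1) (p : E) : g (s • p) ≤ g p := by
  have := hg.2 (Set.mem_univ p) (Set.mem_univ 0) hs0 (by linarith : 0 ≤ 1 - s) (by ring)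
  simp only [smul_zero, add_zero, h0, smul_eq_mul, mul_zero] at this
  nlinarith [hg0 p]

/-- A lower semicontinuous function on `closure C` is approximated from below along rays. -/
theorem eventually_lt_apply_smul {C : Set E} (hC_open : IsOpen C) (hC_conv : Convex ℝ C)
    (hC_zero : (0 : E) ∈ C) {f : E → ℝ≥0∞} (hf_lsc : LowerSemicontinuousOn f (closure C))
    {p : E} (hp : p ∈ closure C) {a : ℝ≥0∞} (ha : a < f p) :
    ∀ᶠ s : ℝ in 𝓝[<] 1, a < f (s • p) := by
  have hlim : Tendsto (fun s : ℝ => s • p) (𝓝[<] 1) (𝓝[closure C] p) := by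
    refine tendsto_nhdsWithin_iff.2 ⟨?_, ?_⟩
    · have : Continuous fun s : ℝ => s • p := by fun_prop
      simpa using (this.tendsto 1).mono_left nhdsWithin_le_nhds
    · filter_upwards [Ioo_mem_nhdsLT (zero_lt_one' ℝ)] with s hs
      exact subset_closure (smul_mem_of_mem_closure hC_open hC_conv hC_zero hp hs.1.le hs.2)
  exact hlim.eventually (hf_lsc p hp a ha)

variable [FiniteDimensional ℝ E]

/-- Coercivity settles large `p`, so by compactness a bound near each point suffices. Off `closure
C` the blow-up of `fk` gives it. At boundary points of `C` no convergence is assumed; there `p` is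
shrunk to `s • p ∈ C`, where `fk → f` uniformly, and `fk k (s • p) ≤ fk k p` carries the bound back.
-/
theorem eventually_lipEnvelope_le {C : Set E} (hC_open : IsOpen C) (hC_conv : Convex ℝ C)
    (hC_zero : (0 : E) ∈ C) {f : E → ℝ≥0∞} (hf_lsc : LowerSemicontinuousOn f (closure C))
    {fk : ℕ → E → ℝ} (hfk_nonneg : ∀ k p, 0 ≤ fk k p)
    (hfk_conv : ∀ k, ConvexOn ℝ Set.univ (fk k)) (hfk_zero : ∀ k, fk k 0 = 0)
    {q c d : ℝ} (hq : 1 < q) (hc : 0 < c) (hfk_coercive : ∀ k p, c * ‖p‖ ^ q - d ≤ fk k p)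
    (hf_finite : ∀ p ∈ C, f p ≠ ∞)
    (hfk_unif : ∀ K : Set E, IsCompact K → K ⊆ C →
      TendstoUniformlyOn fk (fun p => (f p).toReal) atTop K)
    (hfk_infty : ∀ A : Set E, (∃ δ > 0, ∀ p ∈ A, δ ≤ Metric.infDist p (closure C)) →
        ∀ M : ℝ, ∀ᶠ k in atTop, ∀ p ∈ A, M ≤ fk k p)
    (n : ℕ) {ε : ℝ} (hε : 0 < ε) :
    ∀ᶠ k in atTop, ∀ p, lipEnvelope (extendTop (closure C) f) n p ≤ fk k p + ε := by
  set ψ := lipEnvelope (extendTop (closure C) f) n with hψ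
  have hψc : Continuous ψ := continuous_lipEnvelope _ n
  have local_bound : ∀ p₀ : E, ∀ᶠ z : ℕ × E in atTop ×ˢ 𝓝 p₀, ψ z.2 ≤ fk z.1 z.2 + ε := by
    intro p₀
    by_cases hp₀ : p₀ ∈ closure C
    -- If the envelope vanishes at `p₀`, continuity and `fk ≥ 0` suffice. Otherwise there is room
    -- for a positive level `b`.
    · rcases eq_or_lt_of_le (lipEnvelope_nonneg (extendTop (closure C) f) n p₀) with h0 | hpos
      · have h1 : ∀ᶠ p in 𝓝 p₀, ψ p < ε :=
          hψc.continuousAt.eventually_lt continuousAt_const (by rw [hψ, ← h0]; exact hε)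
        filter_upwards [h1.prod_inr atTop] with z hz
        linarith [hfk_nonneg z.1 z.2]
      · obtain ⟨b, hb1, hb2, hb0⟩ : ∃ b, ψ p₀ - ε / 3 < b ∧ b < ψ p₀ ∧ 0 < b := by
          obtain ⟨b, hb, hb'⟩ := exists_between
            (max_lt (sub_lt_self (ψ p₀) (by positivity : 0 < ε / 3)) hpos)
          exact ⟨b, (le_max_left _ _).trans_lt hb, hb', (le_max_right _ _).trans_lt hb⟩
        have hbf : ENNReal.ofReal b < f p₀ := by
          refine lt_of_lt_of_le ?_ ((ofReal_lipEnvelope_le _ n p₀).trans_eq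
            (extendTop_of_mem f hp₀))
          exact (ENNReal.ofReal_lt_ofReal_iff hpos).2 hb2
        obtain ⟨s, hsf, hs⟩ := ((eventually_lt_apply_smul hC_open hC_conv hC_zero hf_lsc hp₀
          hbf).and (Ioo_mem_nhdsLT (zero_lt_one' ℝ))).exists
        have hsC := smul_mem_of_mem_closure hC_open hC_conv hC_zero hp₀ hs.1.le hs.2
        have hcl : closure C ∈ 𝓝 (s • p₀) :=
          mem_of_superset (hC_open.mem_nhds hsC) subset_closure
        have hnear : ∀ᶠ y in 𝓝 (s • p₀), ENNReal.ofReal b < f y := by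
          have := hf_lsc _ (subset_closure hsC) _ hsf
          rwa [nhdsWithin_eq_nhds.2 hcl] at this
        obtain ⟨K, hKn, hKC, hK⟩ := local_compact_nhds (hC_open.mem_nhds hsC)
        have hunif := Metric.tendstoUniformlyOn_iff.1 (hfk_unif K hK hKC) (ε / 3) (by positivity)
        have hsmul : Tendsto (fun p : E => s • p) (𝓝 p₀) (𝓝 (s • p₀)) :=
          (continuous_const_smul s).tendsto p₀
        have hψn : ∀ᶠ p in 𝓝 p₀, ψ p < ψ p₀ + ε / 3 :=
          hψc.continuousAt.eventually_lt continuousAt_const (by linarith)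
        -- The budget is `ψ p < ψ p₀ + ε/3 < b + 2ε/3 < f (s • p) + 2ε/3 < fk (s • p) + ε ≤ fk p +
        -- ε`.
        filter_upwards [hunif.prod_inl (𝓝 p₀), (hsmul.eventually hnear).prod_inr atTop,
          (hsmul.eventually hKn).prod_inr atTop, hψn.prod_inr atTop] with z h1 h2 h3 h4
        have h5 := h1 _ h3
        rw [Real.dist_eq, abs_lt] at h5
        have h6 : b < (f (s • z.2)).toReal :=
          (ENNReal.ofReal_lt_iff_lt_toReal hb0.le (hf_finite _ (hKC h3))).1 h2
        have h7 := (hfk_conv z.1).apply_smul_le_of_zero (hfk_zero z.1) (hfk_nonneg z.1) hs.1.le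
          hs.2.le z.2
        linarith
    · have hne : (closure C).Nonempty := ⟨0, subset_closure hC_zero⟩
      have hpos := (isClosed_closure.notMem_iff_infDist_pos hne).1 hp₀
      have hA : ∀ᶠ p in 𝓝 p₀, Metric.infDist p₀ (closure C) / 2 < Metric.infDist p (closure C) :=
        continuousAt_const.eventually_lt (Metric.continuous_infDist_pt _).continuousAt
          (half_lt_self hpos)
      -- The level `n` is enough, as the envelope never exceeds `n`.
      have hk := hfk_infty {p | Metric.infDist p₀ (closure C) / 2 ≤ Metric.infDist p (closure C)}
        ⟨_, half_pos hpos, fun p hp => hp⟩ n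
      filter_upwards [hk.prod_inl (𝓝 p₀), hA.prod_inr atTop] with z h1 h2
      have := h1 z.2 h2.le
      have := lipEnvelope_le_natCast (extendTop (closure C) f) n z.2
      linarith
  obtain ⟨R, hR⟩ : ∃ R : ℝ, ∀ p : E, R < ‖p‖ → (n : ℝ) ≤ c * ‖p‖ ^ q - d := by
    have : Tendsto (fun r : ℝ => c * r ^ q - d) atTop atTop :=
      tendsto_atTop_add_const_right _ _
        ((tendsto_rpow_atTop (by linarith)).const_mul_atTop hc)
    obtain ⟨R, hR⟩ := (this.eventually_ge_atTop (n : ℝ)).exists_forall_of_atTop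
    exact ⟨R, fun p hp => hR _ hp.le⟩
  have hball : ∀ᶠ k in atTop, ∀ p ∈ Metric.closedBall (0 : E) R, ψ p ≤ fk k p + ε := by
    have hKc : IsCompact (Metric.closedBall (0 : E) R) := isCompact_closedBall _ _
    refine hKc.induction_on (p := fun S => ∀ᶠ k in atTop, ∀ p ∈ S, ψ p ≤ fk k p + ε)
      (by simp) (fun s t hst ht => ht.mono fun k hk p hp => hk p (hst hp))
      (fun s t hs ht => ?_) (fun p _ => ?_)
    · filter_upwards [hs, ht] with k h1 h2 p hp
      exact hp.elim (h1 p) (h2 p)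
    · obtain ⟨pa, ha, pb, hb, hab⟩ := eventually_prod_iff.1 (local_bound p)
      exact ⟨{y | pb y}, mem_nhdsWithin_of_mem_nhds hb, ha.mono fun k hk y hy => hab hk hy⟩
  filter_upwards [hball] with k hk p
  by_cases hp : ‖p‖ ≤ R
  · exact hk p (by simpa using hp)
  · have h1 := hR p (not_le.1 hp)
    have h2 := lipEnvelope_le_natCast (extendTop (closure C) f) n p
    linarith [hfk_coercive k p]

end Convex

/-! ### Two families of admissible integrands -/

section Admissible

variable {l m : ℕ}

/-- A continuous function at bounded distance from `c |v| ^ q` is an admissible integrand with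
recession function `c |v| ^ q`. -/
theorem isAdmissibleIntegrand_of_abs_sub_le (Ω : Set (EuclideanSpace ℝ (Fin l))) {q c M : ℝ}
    (hq : 1 < q) {g : EuclideanSpace ℝ (Fin m) → ℝ} (hg : Continuous g)
    (hM : ∀ v, |g v - c * ‖v‖ ^ q| ≤ M) :
    IsAdmissibleIntegrand Ω q (fun _ v => g v) (fun _ v => c * ‖v‖ ^ q) := by
  refine ⟨by fun_prop, TendstoUniformlyOn.tendstoLocallyUniformlyOn ?_⟩
  rw [Metric.tendstoUniformlyOn_iff]
  intro ε hε
  have hlim : Tendsto (fun t : ℝ => M / t ^ q) atTop (𝓝 0) :=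
    (tendsto_rpow_atTop (by linarith)).const_div_atTop M
  filter_upwards [hlim.eventually_lt_const hε, eventually_gt_atTop 0] with t ht ht0 z _
  have htq : 0 < t ^ q := Real.rpow_pos_of_pos ht0 q
  have h := hM (t • z.2)
  rw [norm_smul, Real.norm_of_nonneg ht0.le, Real.mul_rpow ht0.le (norm_nonneg _)] at h
  have heq : g (t • z.2) / t ^ q - c * ‖z.2‖ ^ q
      = (g (t • z.2) - c * (t ^ q * ‖z.2‖ ^ q)) / t ^ q := by
    field_simp
  rw [dist_comm, Real.dist_eq, heq, abs_div, abs_of_pos htq]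
  exact (div_le_div_of_nonneg_right h htq.le).trans_lt ht

/-- An integrand that is linear in `v` is admissible with vanishing recession function. -/
theorem isAdmissibleIntegrand_mul_coord (Ω : Set (EuclideanSpace ℝ (Fin l))) {q B : ℝ}
    (hq : 1 < q) {φ : EuclideanSpace ℝ (Fin l) → ℝ} (hφ : Continuous φ) (hB : ∀ x, |φ x| ≤ B)
    (i : Fin m) :
    IsAdmissibleIntegrand Ω q (fun x (v : EuclideanSpace ℝ (Fin m)) => φ x * v i)
      (fun _ _ => 0) := by
  refine ⟨by fun_prop, ?_⟩
  rw [Metric.tendstoLocallyUniformlyOn_iff]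
  intro ε hε z₀ _
  have hlim : Tendsto (fun t : ℝ => B * (‖z₀.2‖ + 1) / t ^ (q - 1)) atTop (𝓝 0) :=
    (tendsto_rpow_atTop (by linarith)).const_div_atTop _
  refine ⟨{z | ‖z.2‖ < ‖z₀.2‖ + 1}, mem_nhdsWithin_of_mem_nhds ?_, ?_⟩
  · exact (isOpen_lt (by fun_prop) (by fun_prop)).mem_nhds (by simp)
  filter_upwards [hlim.eventually_lt_const hε, eventually_gt_atTop 0] with t ht ht0 z hz
  have htq : 0 < t ^ (q - 1) := Real.rpow_pos_of_pos ht0 _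
  -- The spare factor `t ^ (q - 1)` tends to infinity because `q > 1`; this kills the recession
  -- function.
  have hsplit : t ^ q = t * t ^ (q - 1) := by
    rw [← Real.rpow_one_add' ht0.le (by linarith)]; congr 1; ring
  have heq : φ z.1 * (t • z.2) i / t ^ q = φ z.1 * z.2 i / t ^ (q - 1) := by
    rw [hsplit, PiLp.smul_apply, smul_eq_mul]
    field_simp
  rw [dist_comm, Real.dist_eq, sub_zero, heq, abs_div, abs_of_pos htq, abs_mul]
  refine lt_of_le_of_lt (div_le_div_of_nonneg_right ?_ htq.le) ht
  have h1 : |z.2 i| ≤ ‖z₀.2‖ + 1 := (PiLp.norm_apply_le z.2 i).trans (le_of_lt hz)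
  exact mul_le_mul (hB _) h1 (abs_nonneg _) ((abs_nonneg _).trans (hB z.1))

end Admissible

/-! ### Consequences of Young measure convergence -/

section YoungMeasure

variable {l m : ℕ} {Ω : Set (EuclideanSpace ℝ (Fin l))} {q : ℝ}
  {Uk : ℕ → EuclideanSpace ℝ (Fin l) → EuclideanSpace ℝ (Fin m)}
  {U : EuclideanSpace ℝ (Fin l) → EuclideanSpace ℝ (Fin m)}
  {ν : EuclideanSpace ℝ (Fin l) → Measure (EuclideanSpace ℝ (Fin m))}
  {lam : Measure (EuclideanSpace ℝ (Fin l))}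
  {νinf : EuclideanSpace ℝ (Fin l) → Measure (Metric.sphere (0 : EuclideanSpace ℝ (Fin m)) 1)}

theorem IsYoungMeasureOf.aemeasurable_lintegral (hν : IsYoungMeasureOf Ω q Uk ν lam νinf)
    {g : EuclideanSpace ℝ (Fin m) → ℝ≥0∞} (hg : Measurable g) :
    AEMeasurable (fun x => ∫⁻ v, g v ∂(ν x)) (volume.restrict Ω) :=
  (Measure.measurable_lintegral hg).comp_aemeasurable hν.aemeasurable_osc

theorem IsYoungMeasureOf.ae_moment_lt_top (hν : IsYoungMeasureOf Ω q Uk ν lam νinf) :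
    ∀ᵐ x ∂(volume.restrict Ω), ∫⁻ v, ‖v‖ₑ ^ q ∂(ν x) < ∞ :=
  ae_lt_top' (hν.aemeasurable_lintegral (by fun_prop)) hν.moment_lt_top.ne

theorem integrable_comp_of_abs_sub_le {α : Type*} [MeasurableSpace α] {μ : Measure α}
    [IsFiniteMeasure μ] {c M : ℝ} (hq : 1 < q) {g : EuclideanSpace ℝ (Fin m) → ℝ}
    (hg : Continuous g) (hM : ∀ v, |g v - c * ‖v‖ ^ q| ≤ M)
    {V : α → EuclideanSpace ℝ (Fin m)} (hV : MemLp V (ENNReal.ofReal q) μ) :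
    Integrable (fun x => g (V x)) μ := by
  have h1 : Integrable (fun x => ‖V x‖ ^ q) μ := by
    have := hV.integrable_norm_rpow (by simpa using by linarith) (by simp)
    rwa [ENNReal.toReal_ofReal (by linarith)] at this
  refine ((h1.const_mul |c|).add (integrable_const M)).mono'
    (hg.comp_aestronglyMeasurable hV.1) (ae_of_all _ fun x => ?_)
  have h2 := abs_add_le (g (V x) - c * ‖V x‖ ^ q) (c * ‖V x‖ ^ q)
  rw [sub_add_cancel, abs_mul, abs_of_nonneg (by positivity : 0 ≤ ‖V x‖ ^ q)] at h2
  have := hM (V x)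
  simp only [Real.norm_eq_abs, Pi.add_apply]
  linarith

/-- The recession function `c|v|^q` is constantly `c` on the unit sphere, so the angle measures
integrate out and only the total mass of `lam` remains. -/
theorem IsYoungMeasureOf.tendsto_lintegral (hν : IsYoungMeasureOf Ω q Uk ν lam νinf)
    (hq : 1 < q) (hΩ_bdd : Bornology.IsBounded Ω)
    (hUk : ∀ k, MemLp (Uk k) (ENNReal.ofReal q) (volume.restrict Ω))
    {c M : ℝ} (hc : 0 ≤ c) {g : EuclideanSpace ℝ (Fin m) → ℝ}
    (hg : Continuous g) (hg0 : ∀ v, 0 ≤ g v) (hM : ∀ v, |g v - c * ‖v‖ ^ q| ≤ M) :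
    Tendsto (fun k => ∫⁻ x in Ω, ENNReal.ofReal (g (Uk k x))) atTop
      (𝓝 ((∫⁻ x in Ω, ∫⁻ v, ENNReal.ofReal (g v) ∂(ν x)) + ENNReal.ofReal c * lam Set.univ)) := by
  have : IsFiniteMeasure (volume.restrict Ω) := ⟨by simpa using hΩ_bdd.measure_lt_top⟩
  have := hν.isFiniteMeasure_conc
  have hG : AEMeasurable (fun x => ∫⁻ v, ENNReal.ofReal (g v) ∂(ν x)) (volume.restrict Ω) :=
    hν.aemeasurable_lintegral (by fun_prop)
  have hbound : ∀ v, ENNReal.ofReal (g v) ≤ ENNReal.ofReal c * ‖v‖ₑ ^ q + ENNReal.ofReal M := by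
    intro v
    have h1 : ‖v‖ₑ ^ q = ENNReal.ofReal (‖v‖ ^ q) := by
      rw [← ofReal_norm, ENNReal.ofReal_rpow_of_nonneg (norm_nonneg v) (by linarith)]
    rw [h1, ← ENNReal.ofReal_mul hc, ← ENNReal.ofReal_add (by positivity)
      ((abs_nonneg _).trans (hM v))]
    exact ENNReal.ofReal_le_ofReal (by linarith [(abs_le.1 (hM v)).2])
  -- Finiteness lets the Bochner integral over `Ω`, which would otherwise default to `0`, be read as
  -- a Lebesgue integral.
  have hGfin : ∫⁻ x in Ω, ∫⁻ v, ENNReal.ofReal (g v) ∂(ν x) ≠ ∞ := by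
    have h2 : ∀ᵐ x ∂(volume.restrict Ω), ∫⁻ v, ENNReal.ofReal (g v) ∂(ν x)
        ≤ ENNReal.ofReal c * ∫⁻ v, ‖v‖ₑ ^ q ∂(ν x) + ENNReal.ofReal M := by
      filter_upwards [hν.isProbabilityMeasure_osc] with x hx
      refine (lintegral_mono hbound).trans_eq ?_
      rw [lintegral_add_right _ measurable_const, lintegral_const_mul _ (by fun_prop)]
      simp
    refine ((lintegral_mono_ae h2).trans_lt ?_).ne
    rw [lintegral_add_right _ measurable_const,
      lintegral_const_mul'' _ (hν.aemeasurable_lintegral (by fun_prop)), lintegral_const]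
    exact ENNReal.add_lt_top.2 ⟨ENNReal.mul_lt_top ENNReal.ofReal_lt_top hν.moment_lt_top,
      ENNReal.mul_lt_top ENNReal.ofReal_lt_top (measure_lt_top _ _)⟩
  have hosc : ∫ x in Ω, ∫ v, g v ∂(ν x)
      = (∫⁻ x in Ω, ∫⁻ v, ENNReal.ofReal (g v) ∂(ν x)).toReal := by
    rw [← integral_toReal hG (ae_lt_top' hG hGfin)]
    refine integral_congr_ae (ae_of_all _ fun x => ?_)
    exact integral_eq_lintegral_of_nonneg_ae (ae_of_all _ hg0) hg.aestronglyMeasurable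
  have hconc : ∫ x, ∫ v : Metric.sphere (0 : EuclideanSpace ℝ (Fin m)) 1,
      c * ‖(v : EuclideanSpace ℝ (Fin m))‖ ^ q ∂(νinf x) ∂lam = c * lam.real Set.univ := by
    have h3 : (fun x => ∫ v : Metric.sphere (0 : EuclideanSpace ℝ (Fin m)) 1,
        c * ‖(v : EuclideanSpace ℝ (Fin m))‖ ^ q ∂(νinf x)) =ᵐ[lam] fun _ => c := by
      filter_upwards [hν.isProbabilityMeasure_angle] with x hx
      simp
    rw [integral_congr_ae h3]
    simp [mul_comm]
  have key := ENNReal.tendsto_ofReal (hν.tendsto_integral _ _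
    (isAdmissibleIntegrand_of_abs_sub_le Ω hq hg hM))
  rw [hosc, hconc, ENNReal.ofReal_add ENNReal.toReal_nonneg (by positivity),
    ENNReal.ofReal_toReal hGfin, ENNReal.ofReal_mul hc, ofReal_measureReal] at key
  refine key.congr fun k => ?_
  exact ofReal_integral_eq_lintegral_ofReal (integrable_comp_of_abs_sub_le hq hg hM (hUk k))
    (ae_of_all _ fun x => hg0 _)

theorem integrable_id_of_lintegral_rpow_lt_top {μ : Measure (EuclideanSpace ℝ (Fin m))}
    [IsFiniteMeasure μ] (hq : 1 < q) (hμ : ∫⁻ v, ‖v‖ₑ ^ q ∂μ < ∞) : Integrable (fun v => v) μ := by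
  refine MemLp.integrable (q := ENNReal.ofReal q) (by simpa using hq.le)
    ⟨by fun_prop, ?_⟩
  rw [eLpNorm_lt_top_iff_lintegral_rpow_enorm_lt_top (by simpa using by linarith) (by simp),
    ENNReal.toReal_ofReal (by linarith)]
  exact hμ

/-- The integrands `φ x * v i` see no concentration, so the Young measure limit and the weak limit
can be compared for every smooth compactly supported `φ`. -/
theorem IsYoungMeasureOf.ae_eq_integral_id (hν : IsYoungMeasureOf Ω q Uk ν lam νinf)
    (hq : 1 < q) (hΩ_bdd : Bornology.IsBounded Ω) (hU : WeaklyConvergesLq Ω q Uk U) :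
    ∀ᵐ x ∂(volume.restrict Ω), U x = ∫ v, v ∂(ν x) := by
  have : IsFiniteMeasure (volume.restrict Ω) := ⟨by simpa using hΩ_bdd.measure_lt_top⟩
  have hcoord : ∀ i : Fin m, ∀ᵐ x ∂(volume.restrict Ω), U x i = ∫ v, v i ∂(ν x) := by
    intro i
    have hUi : Integrable (fun x => U x i) (volume.restrict Ω) := by
      have h1 : Integrable U (volume.restrict Ω) := hU.2.1.integrable (by simpa using hq.le)
      exact (EuclideanSpace.proj i : EuclideanSpace ℝ (Fin m) →L[ℝ] ℝ).integrable_comp h1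
    have hmeas : AEStronglyMeasurable (fun x => ∫ v, v i ∂(ν x)) (volume.restrict Ω) := by
      -- Measurability of `ν` is directly available for integrals of nonnegative functions, hence
      -- the split into positive and negative parts.
      have h1 : AEMeasurable (fun x => (∫⁻ v, ENNReal.ofReal (v i) ∂(ν x)).toReal
          - (∫⁻ v, ENNReal.ofReal (-v i) ∂(ν x)).toReal) (volume.restrict Ω) :=
        (hν.aemeasurable_lintegral (by fun_prop)).ennreal_toReal.sub
          (hν.aemeasurable_lintegral (by fun_prop)).ennreal_toReal
      refine h1.aestronglyMeasurable.congr ?_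
      filter_upwards [hν.isProbabilityMeasure_osc, hν.ae_moment_lt_top] with x hx hx'
      have h2 : Integrable (fun v : EuclideanSpace ℝ (Fin m) => v i) (ν x) :=
        (EuclideanSpace.proj i : EuclideanSpace ℝ (Fin m) →L[ℝ] ℝ).integrable_comp
          (integrable_id_of_lintegral_rpow_lt_top hq hx')
      exact (integral_eq_lintegral_pos_part_sub_lintegral_neg_part h2).symm
    have hint : Integrable (fun x => ∫ v, v i ∂(ν x)) (volume.restrict Ω) := by
      refine ⟨hmeas, ?_⟩
      have h1 : ∀ᵐ x ∂(volume.restrict Ω), ‖∫ v, v i ∂(ν x)‖ₑ ≤ 1 + ∫⁻ v, ‖v‖ₑ ^ q ∂(ν x) := by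
        filter_upwards [hν.isProbabilityMeasure_osc] with x hx
        refine (enorm_integral_le_lintegral_enorm _).trans ?_
        have h2 : ∀ v : EuclideanSpace ℝ (Fin m), ‖v i‖ₑ ≤ 1 + ‖v‖ₑ ^ q := by
          intro v
          have h3 : ‖v i‖ₑ ≤ ‖v‖ₑ := enorm_le_iff_norm_le.2 (PiLp.norm_apply_le v i)
          refine h3.trans ?_
          rcases le_total ‖v‖ₑ 1 with h | h
          · exact h.trans le_self_add
          · calc ‖v‖ₑ = ‖v‖ₑ ^ (1 : ℝ) := by simp
              _ ≤ ‖v‖ₑ ^ q := ENNReal.rpow_le_rpow_of_exponent_le h hq.le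
              _ ≤ _ := le_add_self
        refine (lintegral_mono h2).trans_eq ?_
        rw [lintegral_add_left measurable_const]
        simp
      refine (lintegral_mono_ae h1).trans_lt ?_
      rw [lintegral_add_left measurable_const]
      refine ENNReal.add_lt_top.2 ⟨?_, hν.moment_lt_top⟩
      simpa using hΩ_bdd.measure_lt_top
    refine ae_eq_of_integral_contDiff_smul_eq hUi.locallyIntegrable hint.locallyIntegrable
      fun φ hφ hφs => ?_
    obtain ⟨B, hB⟩ := hφs.exists_bound_of_continuous hφ.continuous
    have hlim := hν.tendsto_integral _ _
      (isAdmissibleIntegrand_mul_coord Ω hq hφ.continuous hB i)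
    have hweak := hU.2.2 (fun x => φ x • EuclideanSpace.single i 1) (by
      refine MemLp.of_bound ?_ B (ae_of_all _ fun x => ?_)
      · exact (hφ.continuous.smul continuous_const).aestronglyMeasurable
      · simpa [norm_smul] using hB x)
    simp only [inner_smul_right, EuclideanSpace.inner_single_right, one_mul, conj_trivial,
      integral_zero, add_zero, integral_const_mul] at hweak hlim
    simpa only [smul_eq_mul] using tendsto_nhds_unique hweak hlim
  filter_upwards [ae_all_iff.2 hcoord, hν.isProbabilityMeasure_osc, hν.ae_moment_lt_top] with
    x hx hp hm
  ext i
  rw [hx i]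
  exact (EuclideanSpace.proj i : EuclideanSpace ℝ (Fin m) →L[ℝ] ℝ).integral_comp_comm
    (integrable_id_of_lintegral_rpow_lt_top hq hm)

/-- The lower bound of the energies by the Young measure, including the concentration. -/
theorem IsYoungMeasureOf.lintegral_add_le_liminf (hν : IsYoungMeasureOf Ω q Uk ν lam νinf)
    (hq : 1 < q) (hΩ_bdd : Bornology.IsBounded Ω)
    (hUk : ∀ k, MemLp (Uk k) (ENNReal.ofReal q) (volume.restrict Ω))
    {F : EuclideanSpace ℝ (Fin m) → ℝ≥0∞} (hF : LowerSemicontinuous F)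
    {fk : ℕ → EuclideanSpace ℝ (Fin m) → ℝ} (hfk_nonneg : ∀ k p, 0 ≤ fk k p)
    {c d : ℝ} (hc : 0 ≤ c) (hd : 0 ≤ d) (hfk_coercive : ∀ k p, c * ‖p‖ ^ q - d ≤ fk k p)
    (hle : ∀ n : ℕ, ∀ ε > 0, ∀ᶠ k in atTop, ∀ p, lipEnvelope F n p ≤ fk k p + ε) :
    (∫⁻ x in Ω, ∫⁻ v, F v ∂(ν x)) + ENNReal.ofReal c * lam Set.univ
      ≤ liminf (fun k => ∫⁻ x in Ω, ENNReal.ofReal (fk k (Uk k x))) atTop := by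
  have : IsFiniteMeasure (volume.restrict Ω) := ⟨by simpa using hΩ_bdd.measure_lt_top⟩
  set L := liminf (fun k => ∫⁻ x in Ω, ENNReal.ofReal (fk k (Uk k x))) atTop with hL
  -- The envelope alone is bounded, so its recession function is zero; the maximum with the coercive
  -- bound retains the concentrated mass.
  let g : ℕ → EuclideanSpace ℝ (Fin m) → ℝ := fun n v =>
    max (lipEnvelope F n v) (c * ‖v‖ ^ q - d)
  have hgc : ∀ n, Continuous (g n) := fun n => by
    refine (continuous_lipEnvelope F n).max ((continuous_const.mul ?_).sub continuous_const)
    exact continuous_norm.rpow_const fun _ => Or.inr (by linarith)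
  have hg0 : ∀ n v, 0 ≤ g n v := fun n v => (lipEnvelope_nonneg F n v).trans (le_max_left _ _)
  have hgM : ∀ n v, |g n v - c * ‖v‖ ^ q| ≤ n + d := fun n v => by
    have h1 := lipEnvelope_le_natCast F n v
    have h2 : 0 ≤ c * ‖v‖ ^ q := by positivity
    have h3 : (0 : ℝ) ≤ n := Nat.cast_nonneg n
    rw [abs_le]
    constructor
    · linarith [le_max_right (lipEnvelope F n v) (c * ‖v‖ ^ q - d)]
    · have : g n v ≤ n + c * ‖v‖ ^ q := max_le (by linarith) (by linarith)
      linarith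
  have hgle : ∀ n, (∫⁻ x in Ω, ∫⁻ v, ENNReal.ofReal (g n v) ∂(ν x))
      + ENNReal.ofReal c * lam Set.univ ≤ L := by
    intro n
    have hlim := hν.tendsto_lintegral hq hΩ_bdd hUk hc (hgc n) (hg0 n) (hgM n)
    have hstep : ∀ ε : ℝ, 0 < ε → (∫⁻ x in Ω, ∫⁻ v, ENNReal.ofReal (g n v) ∂(ν x))
        + ENNReal.ofReal c * lam Set.univ - ENNReal.ofReal ε * volume Ω ≤ L := by
      intro ε hε
      have hlim' := ENNReal.Tendsto.sub hlim
        (tendsto_const_nhds (x := ENNReal.ofReal ε * volume Ω)) (Or.inr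
          (ENNReal.mul_ne_top ENNReal.ofReal_ne_top hΩ_bdd.measure_lt_top.ne))
      rw [← hlim'.liminf_eq]
      refine liminf_le_liminf ?_
      filter_upwards [hle n ε hε] with k hk
      rw [tsub_le_iff_right]
      have h1 : ∀ x, ENNReal.ofReal (g n (Uk k x))
          ≤ ENNReal.ofReal (fk k (Uk k x)) + ENNReal.ofReal ε := fun x => by
        rw [← ENNReal.ofReal_add (hfk_nonneg _ _) hε.le]
        exact ENNReal.ofReal_le_ofReal (max_le (hk _) (by linarith [hfk_coercive k (Uk k x)]))
      refine (lintegral_mono h1).trans_eq ?_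
      rw [lintegral_add_right _ measurable_const]
      simp
    refine ENNReal.le_of_forall_pos_le_add fun δ hδ _ => ?_
    have hvol : 0 < volume.real Ω + 1 := by positivity
    -- The choice `ε = δ / (|Ω| + 1)` makes the error `ε |Ω|` at most `δ`, also when `|Ω| = 0`.
    refine (tsub_le_iff_right.1 (hstep (δ / (volume.real Ω + 1)) (by positivity))).trans ?_
    gcongr
    rw [← ofReal_measureReal hΩ_bdd.measure_lt_top.ne, ← ENNReal.ofReal_mul (by positivity),
      ← ENNReal.ofReal_coe_nnreal]
    refine ENNReal.ofReal_le_ofReal ?_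
    rw [div_mul_eq_mul_div, div_le_iff₀ hvol]
    nlinarith [δ.2]
  have hFle : ∀ v, F v ≤ liminf (fun n => ENNReal.ofReal (g n v)) atTop := fun v =>
    (le_liminf_lipEnvelope hF v).trans (liminf_le_liminf (Eventually.of_forall fun n =>
      ENNReal.ofReal_le_ofReal (le_max_left _ _)))
  -- Fatou is applied twice, in `v` and then in `x`, so monotonicity in `n` is not needed.
  have hinner : ∀ x, ∫⁻ v, F v ∂(ν x)
      ≤ liminf (fun n => ∫⁻ v, ENNReal.ofReal (g n v) ∂(ν x)) atTop := fun x =>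
    (lintegral_mono hFle).trans (lintegral_liminf_le fun n =>
      (hgc n).measurable.ennreal_ofReal)
  have houter : ∫⁻ x in Ω, ∫⁻ v, F v ∂(ν x)
      ≤ liminf (fun n => ∫⁻ x in Ω, ∫⁻ v, ENNReal.ofReal (g n v) ∂(ν x)) atTop :=
    (lintegral_mono hinner).trans (lintegral_liminf_le' fun n =>
      hν.aemeasurable_lintegral (hgc n).measurable.ennreal_ofReal)
  have hlamle : ENNReal.ofReal c * lam Set.univ ≤ L := le_add_self.trans (hgle 0)
  have := hν.isFiniteMeasure_conc
  have hfin : ENNReal.ofReal c * lam Set.univ ≠ ∞ :=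
    ENNReal.mul_ne_top ENNReal.ofReal_ne_top (measure_ne_top _ _)
  calc _ ≤ (L - ENNReal.ofReal c * lam Set.univ) + ENNReal.ofReal c * lam Set.univ := by
        gcongr
        refine houter.trans (liminf_le_of_le (by isBoundedDefault) fun b hb => ?_)
        obtain ⟨n, hn⟩ := hb.exists
        exact hn.trans (ENNReal.le_sub_of_add_le_right hfin (hgle n))
    _ = L := tsub_add_cancel_of_le hlamle

end YoungMeasure

/-! ### Jensen's inequality and its equality case -/

section Jensen

variable {E : Type*} [NormedAddCommGroup E] [NormedSpace ℝ E] {D C : Set E} {f : E → ℝ≥0∞}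

theorem ConvexOn.ennreal_apply_combo_le (hf : ConvexOn ℝ≥0 D f) {x y : E} (hx : x ∈ D)
    (hy : y ∈ D) {a b : ℝ} (ha : 0 ≤ a) (hb : 0 ≤ b) (hab : a + b = 1) :
    f (a • x + b • y) ≤ ENNReal.ofReal a * f x + ENNReal.ofReal b * f y := by
  lift a to ℝ≥0 using ha
  lift b to ℝ≥0 using hb
  have := hf.2 hx hy zero_le zero_le (by exact_mod_cast hab)
  simpa [NNReal.smul_def, ENNReal.smul_def] using this

theorem ConvexOn.ennreal_apply_smul_le (hf : ConvexOn ℝ≥0 D f) (h0D : (0 : E) ∈ D)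
    (hf0 : f 0 = 0) {p : E} (hp : p ∈ D) {s : ℝ} (hs0 : 0 ≤ s) (hs1 : s ≤ 1) :
    f (s • p) ≤ f p := by
  have := hf.ennreal_apply_combo_le hp h0D hs0 (by linarith : 0 ≤ 1 - s) (by ring)
  simp only [smul_zero, add_zero, hf0, mul_zero] at this
  exact this.trans (mul_le_of_le_one_left' (ENNReal.ofReal_le_one.2 hs1))

theorem ConvexOn.convexOn_toReal (hf : ConvexOn ℝ≥0 D f) (hC : Convex ℝ C) (hCD : C ⊆ D)
    (hfin : ∀ p ∈ C, f p ≠ ∞) : ConvexOn ℝ C fun p => (f p).toReal := by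
  refine ⟨hC, fun x hx y hy a b ha hb hab => ?_⟩
  have h := hf.ennreal_apply_combo_le (hCD hx) (hCD hy) ha hb hab
  have h1 : ENNReal.ofReal a * f x ≠ ∞ := ENNReal.mul_ne_top ENNReal.ofReal_ne_top (hfin x hx)
  have h2 : ENNReal.ofReal b * f y ≠ ∞ := ENNReal.mul_ne_top ENNReal.ofReal_ne_top (hfin y hy)
  have := ENNReal.toReal_mono (ENNReal.add_ne_top.2 ⟨h1, h2⟩) h
  rwa [ENNReal.toReal_add h1 h2, ENNReal.toReal_mul, ENNReal.toReal_mul,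
    ENNReal.toReal_ofReal ha, ENNReal.toReal_ofReal hb] at this

variable [FiniteDimensional ℝ E] [MeasurableSpace E] [BorelSpace E]

/-- Jensen's inequality for an extended-valued lower semicontinuous convex function on the
closure of an open convex neighbourhood of the origin. -/
theorem ConvexOn.ennreal_map_integral_le (hC_open : IsOpen C) (hC_conv : Convex ℝ C)
    (hC_zero : (0 : E) ∈ C) (hf : ConvexOn ℝ≥0 (closure C) f)
    (hf_lsc : LowerSemicontinuousOn f (closure C)) (hfin : ∀ p ∈ C, f p ≠ ∞) (hf0 : f 0 = 0)
    {μ : Measure E} [IsProbabilityMeasure μ] (hid : Integrable (fun v => v) μ)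
    (hμ : ∀ᵐ v ∂μ, v ∈ closure C) : f (∫ v, v ∂μ) ≤ ∫⁻ v, f v ∂μ := by
  rcases eq_or_ne (∫⁻ v, f v ∂μ) ∞ with htop | htop
  · rw [htop]; exact le_top
  have hp : ∫ v, v ∂μ ∈ closure C := hC_conv.closure.integral_mem isClosed_closure hμ hid
  -- For `s < 1` the map `v ↦ f (s • v)` is finite and continuous on `closure C`, so real-valued
  -- Jensen applies. Lower semicontinuity then allows `s → 1`.
  have hle : ∀ s ∈ Set.Ioo (0 : ℝ) 1, f (s • ∫ v, v ∂μ) ≤ ∫⁻ v, f v ∂μ := by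
    intro s hs
    have hmaps : Set.MapsTo (fun v : E => s • v) (closure C) C := fun v hv =>
      smul_mem_of_mem_closure hC_open hC_conv hC_zero hv hs.1.le hs.2
    have hconv := hf.convexOn_toReal hC_conv subset_closure hfin
    have hcont : ContinuousOn (fun v : E => (f (s • v)).toReal) (closure C) :=
      (hconv.locallyLipschitzOn hC_open).continuousOn.comp (by fun_prop) hmaps
    have hconv' : ConvexOn ℝ (closure C) fun v : E => (f (s • v)).toReal := by
      refine ⟨hC_conv.closure, fun x hx y hy a b ha hb hab => ?_⟩
      have := hconv.2 (hmaps hx) (hmaps hy) ha hb hab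
      simpa only [smul_add, smul_comm s] using this
    have hmeas : AEStronglyMeasurable (fun v : E => (f (s • v)).toReal) μ := by
      have := hcont.aestronglyMeasurable (μ := μ) isClosed_closure.measurableSet
      rwa [Measure.restrict_eq_self_of_ae_mem hμ] at this
    have hofReal : (fun v => ENNReal.ofReal (f (s • v)).toReal) =ᵐ[μ] fun v => f (s • v) := by
      filter_upwards [hμ] with v hv
      exact ENNReal.ofReal_toReal (hfin _ (hmaps hv))
    have hlint : ∫⁻ v, f (s • v) ∂μ ≤ ∫⁻ v, f v ∂μ := by
      refine lintegral_mono_ae ?_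
      filter_upwards [hμ] with v hv
      exact hf.ennreal_apply_smul_le (subset_closure hC_zero) hf0 hv hs.1.le hs.2.le
    have hint : Integrable (fun v : E => (f (s • v)).toReal) μ := by
      refine ⟨hmeas, (hasFiniteIntegral_iff_ofReal (ae_of_all _ fun v => by positivity)).2 ?_⟩
      rw [lintegral_congr_ae hofReal]
      exact hlint.trans_lt (lt_top_iff_ne_top.2 htop)
    have hJ := ENNReal.ofReal_le_ofReal
      (hconv'.map_integral_le hcont isClosed_closure hμ hid hint)
    rw [ofReal_integral_eq_lintegral_ofReal hint (ae_of_all _ fun v => by positivity),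
      lintegral_congr_ae hofReal, ENNReal.ofReal_toReal (hfin _ (hmaps hp))] at hJ
    exact hJ.trans hlint
  refine le_of_forall_lt fun a ha => ?_
  obtain ⟨s, hs, hs01⟩ := ((eventually_lt_apply_smul hC_open hC_conv hC_zero hf_lsc hp
    ha).and (Ioo_mem_nhdsLT (zero_lt_one' ℝ))).exists
  exact hs.trans_le (hle s hs01)

end Jensen

/-- In the equality case of Jensen's inequality, the measure is supported where the function
agrees with any of its affine minorants that touch it at the barycenter. -/
theorem support_subset_of_lintegral_eq {m : ℕ} {D : Set (EuclideanSpace ℝ (Fin m))}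
    (hD : IsClosed D) {f : EuclideanSpace ℝ (Fin m) → ℝ≥0∞} (hf : LowerSemicontinuousOn f D)
    {μ : Measure (EuclideanSpace ℝ (Fin m))} [IsProbabilityMeasure μ]
    (hid : Integrable (fun v => v) μ) {p z : EuclideanSpace ℝ (Fin m)} (hp : p = ∫ v, v ∂μ)
    (hfp : f p ≠ ∞) (hμ : ∫⁻ v, extendTop D f v ∂μ = f p) (hz : IsSubgradientOn D f p z) :
    μ.support ⊆ {v | 0 ≤ (f p).toReal + inner ℝ z (v - p) ∧
      extendTop D f v ≤ ENNReal.ofReal ((f p).toReal + inner ℝ z (v - p))} := by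
  have hlsc := lowerSemicontinuous_extendTop hD hf
  have hfin : ∀ᵐ v ∂μ, extendTop D f v < ∞ := ae_lt_top hlsc.measurable (hμ.trans_ne hfp)
  have hintF : Integrable (fun v => (extendTop D f v).toReal) μ :=
    integrable_toReal_of_lintegral_ne_top hlsc.measurable.aemeasurable (hμ.trans_ne hfp)
  have hlin : Integrable (fun v => inner ℝ z (v - p)) μ :=
    (hid.sub (integrable_const p)).const_inner z
  have hinta : Integrable (fun v => (f p).toReal + inner ℝ z (v - p)) μ :=
    (integrable_const _).add hlin
  have hle : (fun v => (f p).toReal + inner ℝ z (v - p)) ≤ᵐ[μ]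
      fun v => (extendTop D f v).toReal := by
    filter_upwards [hfin] with v hv
    have hvD : v ∈ D := by
      by_contra h
      rw [extendTop_of_notMem f h] at hv
      exact hv.ne rfl
    rw [extendTop_of_mem f hvD] at hv ⊢
    have := hz v hvD
    rw [← EReal.coe_ennreal_toReal hfp, ← EReal.coe_ennreal_toReal hv.ne] at this
    exact_mod_cast this
  -- As `p` is the barycenter, the affine minorant integrates to `f p`, which is also the integral
  -- of the larger function; the two thus agree a.e.
  have heq : ∫ v, ((f p).toReal + inner ℝ z (v - p)) ∂μ = ∫ v, (extendTop D f v).toReal ∂μ := by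
    rw [integral_toReal hlsc.measurable.aemeasurable hfin, hμ,
      integral_add (integrable_const _) hlin,
      integral_inner (f := fun v => v - p) (hid.sub (integrable_const p)),
      integral_sub hid (integrable_const p)]
    simp [← hp]
  have hae := (integral_eq_iff_of_ae_le hinta hintF hle).1 heq
  have haff : Continuous fun v => (f p).toReal + inner ℝ z (v - p) := by fun_prop
  refine Measure.support_subset_of_isClosed ?_ ?_
  -- Writing contact as an inequality makes the set closed, being a preimage of the closed epigraph;
  -- a closed set of full measure contains the support.
  · have h1 : IsClosed {v | extendTop D f v
        ≤ ENNReal.ofReal ((f p).toReal + inner ℝ z (v - p))} :=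
      (lowerSemicontinuous_iff_isClosed_epigraph.1 hlsc).preimage
        (f := fun v => (v, ENNReal.ofReal ((f p).toReal + inner ℝ z (v - p))))
        (continuous_id.prodMk (ENNReal.continuous_ofReal.comp haff))
    exact (isClosed_le continuous_const haff).inter h1
  · filter_upwards [hae, hfin] with v hv hv'
    refine ⟨?_, ?_⟩
    · rw [hv]; positivity
    · rw [hv, ENNReal.ofReal_toReal hv'.ne]

/-! ### Proof of (i), (ii) and (iii) -/

theorem mainTheorem6 {l m : ℕ} (q : ℝ) (hq : 1 < q)
    (Ω : Set (EuclideanSpace ℝ (Fin l))) (hΩ_open : IsOpen Ω)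
    (hΩ_bdd : Bornology.IsBounded Ω) (hΩ_null : volume (frontier Ω) = 0)
    (C : Set (EuclideanSpace ℝ (Fin m))) (hC_open : IsOpen C) (hC_conv : Convex ℝ C)
    (hC_zero : (0 : EuclideanSpace ℝ (Fin m)) ∈ C)
    -- the limit integrand `f : closure C → [0, ∞]`; its values elsewhere play no role
    (f : EuclideanSpace ℝ (Fin m) → ℝ≥0∞)
    (hf_conv : ConvexOn ℝ≥0 (closure C) f)
    (hf_lsc : LowerSemicontinuousOn f (closure C))
    (fk : ℕ → EuclideanSpace ℝ (Fin m) → ℝ)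
    (hfk_nonneg : ∀ k p, 0 ≤ fk k p)
    (hfk_conv : ∀ k, ConvexOn ℝ Set.univ (fk k))
    (hfk_zero : ∀ k, fk k 0 = 0)
    (c d : ℝ) (hc : 0 < c) (hd : 0 < d)
    (hfk_coercive : ∀ k p, c * ‖p‖ ^ q - d ≤ fk k p)
    -- `fk → f` uniformly on compact subsets of `C` (in particular `f` is finite on `C`)
    (hf_finite : ∀ p ∈ C, f p ≠ ∞)
    (hfk_unif : ∀ K : Set (EuclideanSpace ℝ (Fin m)), IsCompact K → K ⊆ C →
      TendstoUniformlyOn fk (fun p => (f p).toReal) atTop K)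
    -- `fk → +∞` uniformly on sets with positive distance to `closure C`
    (hfk_infty : ∀ A : Set (EuclideanSpace ℝ (Fin m)),
      (∃ δ > 0, ∀ p ∈ A, δ ≤ Metric.infDist p (closure C)) →
        ∀ M : ℝ, ∀ᶠ k in atTop, ∀ p ∈ A, M ≤ fk k p)
    (Uk : ℕ → EuclideanSpace ℝ (Fin l) → EuclideanSpace ℝ (Fin m))
    (U : EuclideanSpace ℝ (Fin l) → EuclideanSpace ℝ (Fin m))
    (hU : WeaklyConvergesLq Ω q Uk U)
    (ν : EuclideanSpace ℝ (Fin l) → Measure (EuclideanSpace ℝ (Fin m)))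
    (lam : Measure (EuclideanSpace ℝ (Fin l)))
    (νinf : EuclideanSpace ℝ (Fin l) →
      Measure (Metric.sphere (0 : EuclideanSpace ℝ (Fin m)) 1))
    (hν : IsYoungMeasureOf Ω q Uk ν lam νinf)
    (hbdd : (⨆ k, ∫⁻ x in Ω, ENNReal.ofReal (fk k (Uk k x))) < ∞) :
    -- (i)
    (∀ᵐ x ∂(volume.restrict Ω), (ν x).support ⊆ closure C) ∧
    -- (ii), together with the fact that `f (U x)` makes sense for almost every `x`
    ((∀ᵐ x ∂(volume.restrict Ω), U x ∈ closure C) ∧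
      (∫⁻ x in Ω, f (U x)) ≤
        liminf (fun k => ∫⁻ x in Ω, ENNReal.ofReal (fk k (Uk k x))) atTop) ∧
    -- (iii)
    ((∫⁻ x in Ω, f (U x)) =
        liminf (fun k => ∫⁻ x in Ω, ENNReal.ofReal (fk k (Uk k x))) atTop →
      lam = 0 ∧
      ∀ᵐ x ∂(volume.restrict Ω), ∀ w : EuclideanSpace ℝ (Fin m),
        (∃ z₀ : EuclideanSpace ℝ (Fin m), IsSubgradientOn (closure C) f (U x) z₀ ∧
          IsStrictAlong (closure C) f (U x) z₀ w) →
        (ν x).support ∩ {v | ∃ s : ℝ, v = U x + s • w} ⊆ {U x}) := by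
  have hF := lowerSemicontinuous_extendTop isClosed_closure hf_lsc
  have hf0 : f 0 = 0 := by
    have h := (hfk_unif {0} isCompact_singleton (by simpa using hC_zero)).tendsto_at
      (Set.mem_singleton 0)
    simp only [hfk_zero] at h
    have h' := tendsto_nhds_unique h tendsto_const_nhds
    exact ((ENNReal.toReal_eq_zero_iff _).1 h').resolve_right (hf_finite 0 hC_zero)
  set L := liminf (fun k => ∫⁻ x in Ω, ENNReal.ofReal (fk k (Uk k x))) atTop with hL
  have hLtop : L < ∞ :=
    (liminf_le_of_le (by isBoundedDefault) fun b hb => by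
      obtain ⟨k, hk⟩ := hb.exists
      exact hk.trans (le_iSup (fun k => ∫⁻ x in Ω, ENNReal.ofReal (fk k (Uk k x))) k)).trans_lt
      hbdd
  have hmain := hν.lintegral_add_le_liminf hq hΩ_bdd hU.1 hF hfk_nonneg hc.le hd.le hfk_coercive
    fun n ε hε => eventually_lipEnvelope_le hC_open hC_conv hC_zero hf_lsc hfk_nonneg hfk_conv
      hfk_zero hq hc hfk_coercive hf_finite hfk_unif hfk_infty n hε
  rw [← hL] at hmain
  have hFle : ∫⁻ x in Ω, ∫⁻ v, extendTop (closure C) f v ∂(ν x) ≤ L := le_self_add.trans hmain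
  have hFmeas := hν.aemeasurable_lintegral hF.measurable
  have hmem : ∀ᵐ x ∂(volume.restrict Ω), ∀ᵐ v ∂(ν x), v ∈ closure C := by
    filter_upwards [ae_lt_top' hFmeas (hFle.trans_lt hLtop).ne] with x hx
    filter_upwards [ae_lt_top hF.measurable hx.ne] with v hv
    by_contra h
    rw [extendTop_of_notMem f h] at hv
    exact hv.ne rfl
  have hbary := hν.ae_eq_integral_id hq hΩ_bdd hU
  have hid : ∀ᵐ x ∂(volume.restrict Ω),
      IsProbabilityMeasure (ν x) ∧ Integrable (fun v => v) (ν x) := by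
    filter_upwards [hν.isProbabilityMeasure_osc, hν.ae_moment_lt_top] with x hx hx'
    exact ⟨hx, integrable_id_of_lintegral_rpow_lt_top hq hx'⟩
  have hjensen : ∀ᵐ x ∂(volume.restrict Ω),
      f (U x) ≤ ∫⁻ v, extendTop (closure C) f v ∂(ν x) := by
    filter_upwards [hmem, hbary, hid] with x hx hb hi
    have := hi.1
    rw [hb]
    refine (hf_conv.ennreal_map_integral_le hC_open hC_conv hC_zero hf_lsc hf_finite hf0 hi.2
      hx).trans_eq (lintegral_congr_ae ?_)
    filter_upwards [hx] with v hv
    rw [extendTop_of_mem f hv]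
  have hUle := lintegral_mono_ae hjensen
  refine ⟨?_, ⟨?_, hUle.trans hFle⟩, fun heq => ?_⟩
  · filter_upwards [hmem] with x hx
    exact Measure.support_subset_of_isClosed isClosed_closure hx
  · filter_upwards [hmem, hbary, hid] with x hx hb hi
    have := hi.1
    rw [hb]
    exact hC_conv.closure.integral_mem isClosed_closure hx hi.2
  have hFL : ∫⁻ x in Ω, ∫⁻ v, extendTop (closure C) f v ∂(ν x) = L :=
    hFle.antisymm (heq ▸ hUle)
  refine ⟨?_, ?_⟩
  · rw [hFL] at hmain
    have h0 : ENNReal.ofReal c * lam Set.univ = 0 := by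
      by_contra h
      exact (ENNReal.lt_add_right hLtop.ne h).not_ge hmain
    rcases mul_eq_zero.1 h0 with h | h
    · exact absurd h (by simpa using hc)
    · exact Measure.measure_univ_eq_zero.1 h
  -- Jensen holds pointwise and both sides have the same finite integral, so it is an equality a.e.
  · have hae := ae_eq_of_ae_le_of_lintegral_le hjensen (heq ▸ hLtop.ne) hFmeas
      (hFL.trans heq.symm).le
    filter_upwards [hmem, hbary, hid, hae, ae_lt_top' hFmeas (hFle.trans_lt hLtop).ne] with
      x hx hb hi he hfin
    rintro w ⟨z, hz, hstrict⟩ v ⟨hv, s, rfl⟩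
    have := hi.1
    have hfp : f (U x) ≠ ∞ := by rw [he]; exact hfin.ne
    obtain ⟨h1, h2⟩ := support_subset_of_lintegral_eq isClosed_closure hf_lsc hi.2 hb hfp
      he.symm hz hv
    have hvC := Measure.support_subset_of_isClosed isClosed_closure hx hv
    rw [extendTop_of_mem f hvC] at h2
    by_contra hne
    have hs : s ≠ 0 := fun h => hne (by simp [h])
    -- Strictness puts `f` above the affine minorant at `U x + s • w`, whereas `h2` puts it at or
    -- below.
    have h3 := hstrict s hs hvC
    rw [add_sub_cancel_left, inner_smul_right] at h1 h2
    have hfv : f (U x + s • w) ≠ ∞ := (h2.trans_lt ENNReal.ofReal_lt_top).ne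
    rw [← EReal.coe_ennreal_toReal hfp, ← EReal.coe_ennreal_toReal hfv] at h3
    have h4 : (f (U x)).toReal + s * inner ℝ z w < (f (U x + s • w)).toReal := by
      exact_mod_cast h3
    have h5 := ENNReal.toReal_mono ENNReal.ofReal_ne_top h2
    rw [ENNReal.toReal_ofReal h1] at h5
    linarith
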